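/- Let $X$ be a connected and locally path connected compact metric space, $\Phi:X\times\mathbf R\to X$, $\Phi(x,t)=x\cdot t$, a continuous flow and $\xi\in\check H^1(X;\mathbf R)$ a Čech cohomology class. Conventions. A continuous closed one-form $\omega$ on $X$ is given by an open cover $\{U\}$ and continuous functions $\varphi_U:U\to\mathbf R$ whose differences are locally constant on overlaps; $[\omega]\in\check H^1(X;\mathbf R)$ is the class of the cocycle $\varphi_V-\varphi_U$, and $\int_\gamma\omega=\sum_k(\varphi_{U_k}(\gamma(t_k))-\varphi_{U_k}(\gamma(t_{k-1})))$ for a subdivision $0=t_0\le\dots\le t_n=1$ with $\gamma([t_{k-1},t_k])\subset U_k$. Every $\xi$ equals $[\omega]$ for some $\omega$; for a loop $\alpha$ put $h_\xi([\alpha])=\int_\alpha\omega$. For a flow on a metric space with metric $d$, a $(\delta,T)$-chain from $x$ to $y$ consists of points $x_0=x,x_1,\dots,x_N=y$, $N\ge1$, and numbers $t_1,\dots,t_N\ge T$ with $d(x_{i-1}\cdot t_i,x_i)<\delta$ for all $i$. The chain recurrent set $R$ of the flow is the set of points $x$ such that for all $\delta>0$, $T\ge1$ there is a $(\delta,T)$-chain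 from $x$ to $x$. A scale of $\xi$ is a pair $\varepsilon,\delta>0$ such that $\xi|_B=0$ for every ball $B\subset X$ of radius $2\varepsilon$ and any two points of $X$ at distance less than $\delta$ can be joined by a path contained in a ball of radius $\varepsilon$; scales exist. Fix any scale $(\varepsilon,\delta)$. Then $R_\xi=R_\xi(\Phi)$ is the set of points $x\in X$ such that for all $0<\delta'<\delta$ and $T>1$ there is a $(\delta',T)$-chain from $x$ to $x$ for which $$\sum_{i=1}^N\int_{x_{i-1}}^{x_{i-1}\cdot t_i}\omega+\sum_{i=1}^N\int_{\sigma_i}\omega=0\qquad([\omega]=\xi)$$ for all paths $\sigma_i$ from $x_{i-1}\cdot t_i$ to $x_i$, each lying in a ball of radius $\varepsilon$; the first integrals are taken along trajectories. (The left side is $\langle\xi,z\rangle$, where $z\in H_1(X;\mathbf Z)$ is the class of the cycle formed by the trajectory parts and the $\sigma_i$.) Let $p_\xi:\tilde X_\xi\to X$ be the free abelian covering determined by $\xi$: the covering with $\tilde X_\xi$ connected and $(p_\xi)_\#\pi_1(\tilde X_\xi,\tilde x_0)=\operatorname{Ker}\big(h_\xi:\pi_1(X,x_0)\to\mathbf R\big)$,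 $x_0=p_\xi(\tilde x_0)$. Let $\tilde\Phi$ be the lift of $\Phi$ to a flow on $\tilde X_\xi$, and let $\tilde d$ be a metric on $\tilde X_\xi$, inducing its topology, that is invariant under the covering transformations and for which $p_\xi$ is a local isometry. Then $R_\xi(\Phi)=p_\xi(R(\tilde\Phi))$, where $R(\tilde\Phi)\subset\tilde X_\xi$ is the chain recurrent set of $\tilde\Phi$ with respect to $\tilde d$. -/

import Mathlib

open Set Topology Filter

universe u v

/-! ### Real Čech cohomology in degree one -/

/-- A Čech `1`-cocycle on `X` with values in the sheaf of locally constant real functions: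
an open cover `U` and locally constant functions `c i j` on `U i ∩ U j` such that
`c i j + c j k = c i k` on `U i ∩ U j ∩ U k`. The values of `c i j` outside `U i ∩ U j`
are irrelevant. -/
structure CechCocycle (X : Type u) [TopologicalSpace X] where
  ι : Type u
  U : ι → Set X
  isOpen : ∀ i, IsOpen (U i)
  cover : ∀ x, ∃ i, x ∈ U i
  c : ι → ι → X → ℝ
  locConst : ∀ i j, ∀ x ∈ U i ∩ U j, ∀ᶠ y in 𝓝 x, c i j y = c i j x
  cocycle : ∀ i j k, ∀ x ∈ U i ∩ U j ∩ U k, c i j x + c j k x = c i k x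

namespace CechCocycle

variable {X : Type u} [TopologicalSpace X]

/-- Two cocycles (on possibly different covers) represent the same element of the direct limit
over all open covers: after restriction to some common refinement `W` of the two covers, they
differ by the coboundary of a family of locally constant functions `f k` on `W k`. -/
def Cohomologous (a b : CechCocycle X) : Prop :=
  ∃ (κ : Type u) (W : κ → Set X) (r : κ → a.ι) (s : κ → b.ι) (f : κ → X → ℝ),
    (∀ k, IsOpen (W k)) ∧ (∀ x, ∃ k, x ∈ W k) ∧
    (∀ k, W k ⊆ a.U (r k)) ∧ (∀ k, W k ⊆ b.U (s k)) ∧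
    (∀ k, ∀ x ∈ W k, ∀ᶠ y in 𝓝 x, f k y = f k x) ∧
    ∀ k l, ∀ x ∈ W k ∩ W l, b.c (s k) (s l) x - a.c (r k) (r l) x = f l x - f k x

theorem Cohomologous.refl (a : CechCocycle X) : a.Cohomologous a :=
  ⟨a.ι, a.U, id, id, fun _ _ => 0, a.isOpen, a.cover, fun _ => Subset.rfl, fun _ => Subset.rfl,
    fun _ _ _ => Eventually.of_forall fun _ => rfl, fun _ _ _ _ => by simp⟩

theorem Cohomologous.symm {a b : CechCocycle X} (h : a.Cohomologous b) : b.Cohomologous a := by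
  obtain ⟨κ, W, r, s, f, h1, h2, h3, h4, h5, h6⟩ := h
  refine ⟨κ, W, s, r, fun k x => - f k x, h1, h2, h4, h3, fun k x hx => ?_, fun k l x hx => ?_⟩
  · filter_upwards [h5 k x hx] with y hy
    rw [hy]
  · have := h6 k l x hx
    linarith

theorem Cohomologous.trans {a b c : CechCocycle X} (h : a.Cohomologous b)
    (h' : b.Cohomologous c) : a.Cohomologous c := by
  obtain ⟨κ, W, r, s, f, h1, h2, h3, h4, h5, h6⟩ := h
  obtain ⟨κ', W', r', s', f', h1', h2', h3', h4', h5', h6'⟩ := h'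
  refine ⟨κ × κ', fun k => W k.1 ∩ W' k.2, fun k => r k.1, fun k => s' k.2,
    fun k x => f k.1 x + f' k.2 x + b.c (s k.1) (r' k.2) x,
    fun k => (h1 _).inter (h1' _), fun x => ?_, fun k => inter_subset_left.trans (h3 _),
    fun k => inter_subset_right.trans (h4' _), fun k x hx => ?_, fun k l x hx => ?_⟩
  · obtain ⟨k, hk⟩ := h2 x
    obtain ⟨k', hk'⟩ := h2' x
    exact ⟨(k, k'), hk, hk'⟩
  · filter_upwards [h5 _ x hx.1, h5' _ x hx.2,
      b.locConst (s k.1) (r' k.2) x ⟨h4 _ hx.1, h3' _ hx.2⟩] with y e1 e2 e3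
    rw [e1, e2, e3]
  · obtain ⟨⟨hk, hk'⟩, hl, hl'⟩ := hx
    have e1 := h6 k.1 l.1 x ⟨hk, hl⟩
    have e2 := h6' k.2 l.2 x ⟨hk', hl'⟩
    have e3 := b.cocycle (s k.1) (s l.1) (r' l.2) x ⟨⟨h4 _ hk, h4 _ hl⟩, h3' _ hl'⟩
    have e4 := b.cocycle (s k.1) (r' k.2) (r' l.2) x ⟨⟨h4 _ hk, h3' _ hk'⟩, h3' _ hl'⟩
    simp only
    linarith

instance setoid (X : Type u) [TopologicalSpace X] : Setoid (CechCocycle X) :=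
  ⟨Cohomologous, Cohomologous.refl, Cohomologous.symm, Cohomologous.trans⟩

/-- The zero cocycle, on the cover of `X` by itself. -/
def trivial (X : Type u) [TopologicalSpace X] : CechCocycle X where
  ι := PUnit
  U _ := univ
  isOpen _ := isOpen_univ
  cover x := ⟨PUnit.unit, mem_univ x⟩
  c _ _ _ := 0
  locConst _ _ _ _ := Eventually.of_forall fun _ => rfl
  cocycle _ _ _ _ _ := by simp

/-- Pullback of a cocycle along a continuous map. -/
def pullback {Y : Type u} [TopologicalSpace Y] (h : C(Y, X)) (a : CechCocycle X) :
    CechCocycle Y where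
  ι := a.ι
  U i := h ⁻¹' a.U i
  isOpen i := (a.isOpen i).preimage h.continuous
  cover y := a.cover (h y)
  c i j y := a.c i j (h y)
  locConst i j y hy := h.continuous.continuousAt.eventually (a.locConst i j (h y) hy)
  cocycle i j k y hy := a.cocycle i j k (h y) hy

theorem Cohomologous.pullback {Y : Type u} [TopologicalSpace Y] (h : C(Y, X))
    {a b : CechCocycle X} (hab : a.Cohomologous b) :
    (a.pullback h).Cohomologous (b.pullback h) := by
  obtain ⟨κ, W, r, s, f, h1, h2, h3, h4, h5, h6⟩ := hab
  exact ⟨κ, fun k => h ⁻¹' W k, r, s, fun k y => f k (h y),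
    fun k => (h1 k).preimage h.continuous, fun y => h2 (h y),
    fun k => preimage_mono (h3 k), fun k => preimage_mono (h4 k),
    fun k y hy => h.continuous.continuousAt.eventually (h5 k (h y) hy),
    fun k l y hy => h6 k l (h y) hy⟩

end CechCocycle

/-- The Čech cohomology `Ȟ¹(X; ℝ)`: the direct limit of `H¹(𝒰; ℝ)` over all open covers `𝒰`. -/
def CechH1 (X : Type u) [TopologicalSpace X] : Type (u + 1) :=
  Quotient (CechCocycle.setoid X)

namespace CechH1

variable {X : Type u} [TopologicalSpace X]

/-- The class of a cocycle. -/
def mk (a : CechCocycle X) : CechH1 X := Quotient.mk _ a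

instance : Zero (CechH1 X) := ⟨mk (CechCocycle.trivial X)⟩

/-- The induced map `h^* : Ȟ¹(X; ℝ) → Ȟ¹(Y; ℝ)`. -/
def pullback {Y : Type u} [TopologicalSpace Y] (h : C(Y, X)) : CechH1 X → CechH1 Y :=
  Quotient.map (CechCocycle.pullback h) fun _ _ hab => hab.pullback h

/-- The restriction `ξ|_B` of a class to a subset. -/
def restrict (ξ : CechH1 X) (B : Set X) : CechH1 B :=
  ξ.pullback ⟨Subtype.val, continuous_subtype_val⟩

end CechH1

/-! ### Continuous closed one-forms and their integrals -/

/-- A continuous closed one-form on `X`, presented by an open cover `U` and continuous functions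
`φ i` on `U i` whose differences are locally constant on `U i ∩ U j`. The values of `φ i`
outside `U i` are irrelevant. (The form itself is the equivalence class of such a family;
its cohomology class and its line integrals only depend on the equivalence class.) -/
structure ClosedOneForm (X : Type u) [TopologicalSpace X] where
  ι : Type u
  U : ι → Set X
  isOpen : ∀ i, IsOpen (U i)
  cover : ∀ x, ∃ i, x ∈ U i
  φ : ι → X → ℝ
  cont : ∀ i, ContinuousOn (φ i) (U i)
  locConst : ∀ i j, ∀ x ∈ U i ∩ U j, ∀ᶠ y in 𝓝 x, φ j y - φ i y = φ j x - φ i x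

namespace ClosedOneForm

variable {X : Type u} [TopologicalSpace X]

/-- The cocycle `φ j - φ i` of a closed one-form. -/
def toCocycle (ω : ClosedOneForm X) : CechCocycle X where
  ι := ω.ι
  U := ω.U
  isOpen := ω.isOpen
  cover := ω.cover
  c i j x := ω.φ j x - ω.φ i x
  locConst := ω.locConst
  cocycle _ _ _ _ _ := by ring

/-- The Čech cohomology class `[ω]`: the image of `ω` under the connecting homomorphism of
`0 → ℝ_X → C_X → B_X → 0`. -/
def cechClass (ω : ClosedOneForm X) : CechH1 X := CechH1.mk ω.toCocycle

/-- `r` is the value of the sum `∑ φ_{i_k}(γ(t_{k+1})) - φ_{i_k}(γ(t_k))` for a subdivision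
`0 = t_0 ≤ t_1 ≤ ⋯ ≤ t_N = 1` with `γ([t_k, t_{k+1}])` contained in `U_{i_k}`. -/
def IsIntegralSum (ω : ClosedOneForm X) {x y : X} (γ : Path x y) (r : ℝ) : Prop :=
  ∃ (N : ℕ) (t : ℕ → unitInterval) (i : ℕ → ω.ι), Monotone t ∧ t 0 = 0 ∧ t N = 1 ∧
    (∀ k < N, ∀ s ∈ Icc (t k) (t (k + 1)), γ s ∈ ω.U (i k)) ∧
    r = ∑ k ∈ Finset.range N, (ω.φ (i k) (γ (t (k + 1))) - ω.φ (i k) (γ (t k)))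

theorem exists_isIntegralSum (ω : ClosedOneForm X) {x y : X} (γ : Path x y) :
    ∃ r, ω.IsIntegralSum γ r := by
  obtain ⟨t, h0, hm, ⟨N, hN⟩, hc⟩ := exists_monotone_Icc_subset_open_cover_unitInterval
    (c := fun i => γ ⁻¹' ω.U i) (fun i => (ω.isOpen i).preimage γ.continuous)
    (fun s _ => mem_iUnion.2 (ω.cover (γ s)))
  choose i hi using hc
  exact ⟨_, N, t, i, hm, h0, hN N le_rfl, fun k _ s hs => hi k hs, rfl⟩

/-- The line integral `∫_γ ω` (the sum above; it does not depend on the subdivision). -/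
noncomputable def integral (ω : ClosedOneForm X) {x y : X} (γ : Path x y) : ℝ :=
  (ω.exists_isIntegralSum γ).choose

end ClosedOneForm

namespace CechH1

variable {X : Type u} [TopologicalSpace X]

/-- On a paracompact Hausdorff space every class is the class of a closed one-form. -/
theorem exists_form [T2Space X] [ParacompactSpace X] (ξ : CechH1 X) :
    ∃ ω : ClosedOneForm X, ω.cechClass = ξ := by
  induction ξ using Quotient.ind with
  | _ a =>
    obtain ⟨ρ, hρ⟩ := PartitionOfUnity.exists_isSubordinate (isClosed_univ (X := X)) a.U a.isOpen
      (fun x _ => mem_iUnion.2 (a.cover x))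
    have key : ∀ i j, ∀ x ∈ a.U i ∩ a.U j,
        (-∑ᶠ k, ρ k x * a.c j k x) - (-∑ᶠ k, ρ k x * a.c i k x) = a.c i j x := by
      intro i j x hx
      have hfin : ∀ g : a.ι → ℝ, (Function.support fun k => ρ k x * g k).Finite := fun g =>
        (ρ.locallyFinite.point_finite x).subset fun k hk => by
          have hk' : ρ k x * g k ≠ 0 := hk
          exact left_ne_zero_of_mul hk'
      have h1 : ∑ᶠ k, ρ k x * a.c i k x - ∑ᶠ k, ρ k x * a.c j k x
          = ∑ᶠ k, ρ k x * a.c i j x := by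
        rw [← finsum_sub_distrib (hfin _) (hfin _)]
        refine finsum_congr fun k => ?_
        by_cases hk : ρ k x = 0
        · simp [hk]
        · have hxk : x ∈ a.U k := hρ k (subset_tsupport _ hk)
          have := a.cocycle i j k x ⟨hx, hxk⟩
          rw [← mul_sub]
          congr 1
          linarith
      have h2 : ∑ᶠ k, ρ k x * a.c i j x = a.c i j x := by
        rw [← finsum_mul' _ _ (ρ.locallyFinite.point_finite x), ρ.sum_eq_one (mem_univ x), one_mul]
      linarith
    refine ⟨⟨a.ι, a.U, a.isOpen, a.cover, fun i x => -∑ᶠ k, ρ k x * a.c i k x, fun i x hx => ?_,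
      fun i j x hx => ?_⟩, ?_⟩
    · refine ContinuousAt.continuousWithinAt (ContinuousAt.neg ?_)
      obtain ⟨s, hs⟩ := ρ.exists_finset_nhds x
      have hev : (fun y => ∑ᶠ k, ρ k y * a.c i k y) =ᶠ[𝓝 x]
          fun y => ∑ k ∈ s, ρ k y * a.c i k y := by
        filter_upwards [hs] with y hy
        refine finsum_eq_sum_of_support_subset _ fun k hk => hy.2 ?_
        have hk' : ρ k y * a.c i k y ≠ 0 := hk
        exact left_ne_zero_of_mul hk'
      refine ContinuousAt.congr ?_ hev.symm
      refine tendsto_finsetSum _ fun k _ => ?_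
      change ContinuousAt (fun y => ρ k y * a.c i k y) x
      by_cases hxk : x ∈ tsupport (ρ k)
      · refine ((ρ k).continuous.continuousAt).mul ?_
        exact continuousAt_const.congr
          ((a.locConst i k x ⟨hx, hρ k hxk⟩).mono fun y hy => hy.symm)
      · have h0 : (fun _ => (0 : ℝ)) =ᶠ[𝓝 x] fun y => ρ k y * a.c i k y := by
          filter_upwards [(isClosed_tsupport (ρ k)).isOpen_compl.mem_nhds hxk] with y hy
          rw [image_eq_zero_of_notMem_tsupport hy, zero_mul]
        exact continuousAt_const.congr h0
    · filter_upwards [a.locConst i j x hx,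
        ((a.isOpen i).inter (a.isOpen j)).mem_nhds hx] with y hy hyU
      rw [key i j y hyU, key i j x hx, hy]
    · refine Quotient.sound (CechCocycle.Cohomologous.symm ?_)
      exact ⟨a.ι, a.U, id, id, fun _ _ => 0, a.isOpen, a.cover, fun _ => Subset.rfl,
        fun _ => Subset.rfl, fun _ _ _ => Eventually.of_forall fun _ => rfl,
        fun k l x hx => by
          simp only [id, ClosedOneForm.toCocycle, sub_zero]
          rw [key k l x hx, sub_self]⟩

/-- A closed one-form representing the class `ξ`. -/
noncomputable def form [T2Space X] [ParacompactSpace X] (ξ : CechH1 X) : ClosedOneForm X :=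
  ξ.exists_form.choose

/-- The period `h_ξ([α]) = ⟨ξ, [α]⟩ = ∫_α ω` of `ξ` along a loop, where `[ω] = ξ`. -/
noncomputable def period [T2Space X] [ParacompactSpace X] (ξ : CechH1 X) {x₀ : X}
    (α : Path x₀ x₀) : ℝ :=
  ξ.form.integral α

end CechH1

/-! ### Chains and chain recurrence -/

/-- The part of the trajectory from `x` to `x · t`. -/
def Flow.orbitPath {X : Type u} [TopologicalSpace X] (Φ : Flow ℝ X) (x : X) (t : ℝ) :
    Path x (Φ t x) where
  toFun s := Φ ((s : ℝ) * t) x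
  continuous_toFun := by fun_prop
  source' := by simp
  target' := by simp

/-- A `(δ, T)`-chain from `a` to `b`: points `a = x_0, …, x_N = b`, `N ≥ 1`, and times
`t_1, …, t_N ≥ T` with `d(x_{i-1} · t_i, x_i) < δ`. -/
structure DynChain {X : Type u} [MetricSpace X] (Φ : Flow ℝ X) (δ T : ℝ) (a b : X) where
  N : ℕ
  pos : 1 ≤ N
  x : Fin (N + 1) → X
  t : Fin N → ℝ
  x_zero : x 0 = a
  x_last : x (Fin.last N) = b
  le_t : ∀ i, T ≤ t i
  dist_lt : ∀ i, dist (Φ (t i) (x i.castSucc)) (x i.succ) < δ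

/-- The chain recurrent set `R(Φ)`. -/
def chainRecurrentSet {X : Type u} [MetricSpace X] (Φ : Flow ℝ X) : Set X :=
  {x | ∀ δ T : ℝ, 0 < δ → 1 ≤ T → Nonempty (DynChain Φ δ T x x)}

/-- `(ε, δ)` is a scale of `ξ`: `ξ` vanishes on balls of radius `2ε`, and any two points at distance
less than `δ` can be connected by a path inside a ball of radius `ε`. -/
structure IsScale {X : Type u} [MetricSpace X] (ξ : CechH1 X) (ε δ : ℝ) : Prop where
  ε_pos : 0 < ε
  δ_pos : 0 < δ
  restrict_ball : ∀ x : X, ξ.restrict (Metric.ball x (2 * ε)) = 0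
  joined : ∀ x y : X, dist x y < δ → ∃ (γ : Path x y) (c : X), range γ ⊆ Metric.ball c ε

/-- A class `ξ` vanishes on every set of the cover on which a representing cocycle lives. -/
theorem CechH1.restrict_mk_eq_zero {X : Type u} [TopologicalSpace X] (a : CechCocycle X)
    (i : a.ι) {B : Set X} (hB : B ⊆ a.U i) : (CechH1.mk a).restrict B = 0 := by
  refine Quotient.sound ?_
  refine ⟨a.ι, fun k => Subtype.val ⁻¹' a.U k, id, fun _ => PUnit.unit,
    fun k y => a.c k i y, fun k => (a.isOpen k).preimage continuous_subtype_val,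
    fun y => a.cover y, fun _ => Subset.rfl, fun _ => subset_univ _, fun k y hy => ?_,
    fun k l y hy => ?_⟩
  · exact continuous_subtype_val.continuousAt.eventually (a.locConst k i y ⟨hy, hB y.2⟩)
  · have := a.cocycle k l i y ⟨⟨hy.1, hy.2⟩, hB y.2⟩
    simp only [CechCocycle.pullback, CechCocycle.trivial, id, ContinuousMap.coe_mk]
    linarith

/-- Every class on a compact, locally path connected metric space has a scale. -/
theorem exists_isScale {X : Type u} [MetricSpace X] [CompactSpace X]
    [LocallyPathConnectedSpace X] (ξ : CechH1 X) : ∃ ε δ, IsScale ξ ε δ := by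
  induction ξ using Quotient.ind with
  | _ a =>
    obtain ⟨r, hr, hball⟩ := lebesgue_number_lemma_of_metric (isCompact_univ (X := X))
      a.isOpen (fun x _ => mem_iUnion.2 (a.cover x))
    have hbasis : ∀ x : X, ∃ V ⊆ Metric.ball x (r / 2), IsOpen V ∧ x ∈ V ∧ IsPathConnected V := by
      intro x
      obtain ⟨V, ⟨hV, hxV, hVc⟩, hVs⟩ :=
        (isOpen_isPathConnected_basis x).mem_iff.1 (Metric.ball_mem_nhds x (half_pos hr))
      exact ⟨V, hVs, hV, hxV, hVc⟩
    choose V hVs hVo hxV hVc using hbasis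
    obtain ⟨δ, hδ, hδb⟩ := lebesgue_number_lemma_of_metric (isCompact_univ (X := X))
      hVo (fun x _ => mem_iUnion.2 ⟨x, hxV x⟩)
    refine ⟨r / 2, δ, half_pos hr, hδ, fun x => ?_, fun x y hxy => ?_⟩
    · obtain ⟨i, hi⟩ := hball x (mem_univ x)
      rw [mul_div_cancel₀ r two_ne_zero]
      exact CechH1.restrict_mk_eq_zero a i hi
    · obtain ⟨c, hc⟩ := hδb x (mem_univ x)
      have hx : x ∈ V c := hc (Metric.mem_ball_self hδ)
      have hy : y ∈ V c := hc (by rwa [Metric.mem_ball, dist_comm])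
      obtain ⟨γ, hγ⟩ := (hVc c).joinedIn x hx y hy
      exact ⟨γ, c, range_subset_iff.2 fun s => hVs c (hγ s)⟩

namespace DynChain

variable {X : Type u} [MetricSpace X] {Φ : Flow ℝ X} {δ T : ℝ} {x : X}

/-- A choice of paths `σ_i` from `x_{i-1} · t_i` to `x_i`, each inside a ball of radius `ε`.
Together with the trajectory parts these make up the singular cycles whose homology classes are
associated with a closed chain. -/
structure Connection (C : DynChain Φ δ T x x) (ε : ℝ) where
  σ : ∀ i : Fin C.N, Path (Φ (C.t i) (C.x i.castSucc)) (C.x i.succ)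
  small : ∀ i, ∃ c, range (σ i) ⊆ Metric.ball c ε

/-- The value `⟨ξ, z⟩ = ∑ ∫_{x_{i-1}}^{x_{i-1} · t_i} ω + ∑ ∫_{σ_i} ω` on the homology class `z`
of the singular cycle made up of the trajectory parts and the connecting paths, where
`[ω] = ξ`. -/
noncomputable def pairing (ξ : CechH1 X) (C : DynChain Φ δ T x x) {ε : ℝ}
    (s : C.Connection ε) : ℝ :=
  ∑ i, ξ.form.integral (Φ.orbitPath (C.x i.castSucc) (C.t i)) + ∑ i, ξ.form.integral (s.σ i)

end DynChain

/-- The chain recurrent set `R_ξ(Φ)`, formed with a scale `(ε, δ)` of `ξ`. -/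
def chainRecurrentSetOfClass {X : Type u} [MetricSpace X] (Φ : Flow ℝ X) (ξ : CechH1 X)
    (ε δ : ℝ) : Set X :=
  {x | ∀ δ' T : ℝ, 0 < δ' → δ' < δ → 1 < T →
    ∃ C : DynChain Φ δ' T x x, ∀ s : C.Connection ε, C.pairing ξ s = 0}

/-! ### The free abelian covering determined by a class -/

/-- `p : E → X` is the covering determined by `ξ`, with base point `e₀`: `E` is connected, and
`p_# π₁(E, e₀)` is the kernel of the homomorphism of periods
`h_ξ : π₁(X, p e₀) → ℝ`, `[α] ↦ ⟨ξ, [α]⟩`. -/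
structure IsCoveringOfClass {X : Type u} [MetricSpace X] {E : Type v} [TopologicalSpace E]
    (ξ : CechH1 X) (p : C(E, X)) (e₀ : E) : Prop where
  connected : ConnectedSpace E
  isCoveringMap : IsCoveringMap p
  mem_range_iff : ∀ α : Path (p e₀) (p e₀),
    FundamentalGroup.fromPath (Path.Homotopic.Quotient.mk α) ∈ (FundamentalGroup.map p e₀).range ↔
      ξ.period α = 0

/-! Let ω = `ξ.form`. A loop in E projects to a loop of zero period, so integrating ω along
projections of paths from `e₀` defines a primitive F of the pullback of ω. Conversely, a loop of
zero period lies in the image of the fundamental group of E and lifts to a closed loop, so F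
separates the points of each fibre (`exists_isPrimitive`). A closed chain of `Φ` at x, lifted step
by step from e over x, ends at some e' over x, and its pairing with ξ telescopes to F(e') - F(e)
(`DynChain.pairing_eq`). Hence the pairing vanishes exactly when the lifted chain closes up.

It remains to translate small jumps in X into small jumps in E and back, uniformly although E need
not be compact. Shifting F by a constant gives deck transformations transitive on fibres; they are
isometries by hypothesis, so local estimates on E become uniform by compactness of X
(`exists_forall_of_eventually`). The choice of connecting paths is harmless because ω has a
primitive on balls of radius 2ε (`integral_eq_of_range_subset`). -/

/-! ### Primitives along maps and line integrals -/

namespace ClosedOneForm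

variable {X : Type u} [TopologicalSpace X] (ω : ClosedOneForm X)

/-- `G` is a primitive of the pullback of `ω` along `f`. -/
def IsPrimitive {Y : Type*} [TopologicalSpace Y] (f : Y → X) (G : Y → ℝ) : Prop :=
  ∀ i y, f y ∈ ω.U i → ∀ᶠ z in 𝓝 y, G z - ω.φ i (f z) = G y - ω.φ i (f y)

variable {ω} {Y Z : Type*} [TopologicalSpace Y] [TopologicalSpace Z]

theorem IsPrimitive.comp {f : Y → X} {G : Y → ℝ} (h : ω.IsPrimitive f G) {g : Z → Y}
    (hg : Continuous g) : ω.IsPrimitive (f ∘ g) (G ∘ g) := fun i y hy =>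
  hg.continuousAt.eventually (h i (g y) hy)

/-- Changing charts alters the local function only by a locally constant one, so a single chart at
each point suffices. -/
theorem isPrimitive_of_exists {f : Y → X} (hf : Continuous f) {G : Y → ℝ}
    (h : ∀ y, ∃ i, f y ∈ ω.U i ∧ ∀ᶠ z in 𝓝 y, G z - ω.φ i (f z) = G y - ω.φ i (f y)) :
    ω.IsPrimitive f G := by
  intro j y hy
  obtain ⟨i, hi, hG⟩ := h y
  filter_upwards [hG, hf.continuousAt.eventually (ω.locConst i j (f y) ⟨hi, hy⟩)] with z h1 h2
  linarith

theorem isPrimitive_of_forall_mem {f : Y → X} (hf : Continuous f) {i : ω.ι}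
    (h : ∀ y, f y ∈ ω.U i) : ω.IsPrimitive f (ω.φ i ∘ f) :=
  isPrimitive_of_exists hf fun y => ⟨i, h y, Eventually.of_forall fun z => by simp⟩

theorem IsPrimitive.isLocallyConstant_sub {f : Y → X} {G G' : Y → ℝ} (h : ω.IsPrimitive f G)
    (h' : ω.IsPrimitive f G') : IsLocallyConstant fun y => G y - G' y := by
  rw [IsLocallyConstant.iff_eventually_eq]
  intro y
  obtain ⟨i, hi⟩ := ω.cover (f y)
  filter_upwards [h i y hi, h' i y hi] with z h1 h2
  linarith

theorem IsPrimitive.sub_eq_sub [PreconnectedSpace Y] {f : Y → X} {G G' : Y → ℝ}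
    (h : ω.IsPrimitive f G) (h' : ω.IsPrimitive f G') (a b : Y) : G b - G a = G' b - G' a := by
  have := (h.isLocallyConstant_sub h').apply_eq_of_preconnectedSpace a b
  linarith

/-- On each subinterval the chart function is itself a primitive, so it has the same increment as G,
and the sum telescopes. In particular the arbitrary choice made in `integral` is immaterial. -/
theorem IsPrimitive.eq_sub_of_isIntegralSum {x y : X} {γ : Path x y} {G : unitInterval → ℝ}
    (h : ω.IsPrimitive γ G) {r : ℝ} (hr : ω.IsIntegralSum γ r) : r = G 1 - G 0 := by
  obtain ⟨N, t, i, hm, h0, h1, hU, rfl⟩ := hr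
  rw [← h0, ← h1, ← Finset.sum_range_sub (fun k => G (t k))]
  refine Finset.sum_congr rfl fun k hk => ?_
  have : PreconnectedSpace (Icc (t k) (t (k + 1))) :=
    Subtype.preconnectedSpace isPreconnected_Icc
  have hc : Continuous (γ ∘ ((↑) : Icc (t k) (t (k + 1)) → unitInterval)) :=
    γ.continuous.comp continuous_subtype_val
  have hle := hm (Nat.le_succ k)
  exact (isPrimitive_of_forall_mem hc fun s => hU k (Finset.mem_range.1 hk) s s.2).sub_eq_sub
    (h.comp continuous_subtype_val) ⟨t k, left_mem_Icc.2 hle⟩ ⟨t (k + 1), right_mem_Icc.2 hle⟩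

theorem IsPrimitive.integral_eq {x y : X} {γ : Path x y} {G : unitInterval → ℝ}
    (h : ω.IsPrimitive γ G) : ω.integral γ = G 1 - G 0 :=
  h.eq_sub_of_isIntegralSum (ω.exists_isIntegralSum γ).choose_spec

theorem exists_isPrimitive_unitInterval (ω : ClosedOneForm X) {f : unitInterval → X}
    (hf : Continuous f) : ∃ G, ω.IsPrimitive f G := by
  obtain ⟨t, h0, hm, ⟨N, hN⟩, hc⟩ := exists_monotone_Icc_subset_open_cover_unitInterval
    (c := fun i => f ⁻¹' ω.U i) (fun i => (ω.isOpen i).preimage hf)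
    (fun s _ => mem_iUnion.2 (ω.cover (f s)))
  -- Induction over the path stopped at time `t k`: it is defined on the whole interval, so no
  -- gluing of functions on subintervals is needed.
  have key : ∀ k, ∃ G, ω.IsPrimitive (fun s => f (min s (t k))) G := by
    intro k
    induction k with
    | zero => exact ⟨fun _ => 0, fun i y _ => Eventually.of_forall fun z => by simp [h0]⟩
    | succ k ih =>
      obtain ⟨G, hG⟩ := ih
      obtain ⟨i, hi⟩ := hc k
      have hab : t k ≤ t (k + 1) := hm (Nat.le_succ k)
      generalize t k = a at *
      generalize t (k + 1) = b at *
      -- The added term vanishes for s ≤ a, follows the chart function on [a, b] and is constant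
      -- after b.
      refine ⟨fun s => G s + (ω.φ i (f (max a (min s b))) - ω.φ i (f a)), fun j y hy => ?_⟩
      rcases lt_or_ge y a with hya | hya
      · have hyab : min y b = min y a := by
          rw [min_eq_left hya.le, min_eq_left (hya.le.trans hab)]
        filter_upwards [hG j y (by simpa only [← hyab] using hy), Iio_mem_nhds hya] with z hz hza
        have hza : z < a := hza
        have hzab : min z b = min z a := by
          rw [min_eq_left hza.le, min_eq_left (hza.le.trans hab)]
        rw [hyab, hzab, max_eq_left (min_le_right z a), max_eq_left (min_le_right y a)]
        linarith
      · have hya' : min y a = a := min_eq_right hya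
        have hyU : f (min y b) ∈ ω.U i := hi ⟨le_min hya hab, min_le_right _ _⟩
        have haU : f (min y a) ∈ ω.U i := by rw [hya']; exact hi ⟨le_rfl, hab⟩
        have hcont : Continuous fun s => f (min s b) := by fun_prop
        filter_upwards [hG i y haU,
          hcont.continuousAt.eventually (ω.locConst i j _ ⟨hyU, hy⟩)] with z h1 h2
        rw [hya'] at h1
        rw [max_eq_right (le_min hya hab)]
        rcases lt_or_ge z a with hza | hza
        · have hzb : min z b = z := min_eq_left (hza.le.trans hab)
          rw [min_eq_left hza.le] at h1
          rw [hzb] at h2 ⊢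
          rw [max_eq_left hza.le]
          linarith
        · rw [min_eq_right hza] at h1
          rw [max_eq_right (le_min hza hab)]
          linarith
  obtain ⟨G, hG⟩ := key N
  refine ⟨G, ?_⟩
  have : (fun s => f (min s (t N))) = f := by
    ext s
    rw [hN N le_rfl, min_eq_left unitInterval.le_one']
  rwa [this] at hG

/-- A primitive along the concatenation, restricted to the two halves, is a primitive along each
path. -/
theorem integral_trans (ω : ClosedOneForm X) {x y z : X} (γ : Path x y) (γ' : Path y z) :
    ω.integral (γ.trans γ') = ω.integral γ + ω.integral γ' := by
  obtain ⟨G, hG⟩ := ω.exists_isPrimitive_unitInterval (γ.trans γ').continuous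
  let l : unitInterval → unitInterval := fun s =>
    ⟨(s : ℝ) / 2, by have := s.2.1; positivity, by have := s.2.2; linarith⟩
  let r : unitInterval → unitInterval := fun s =>
    ⟨(1 + (s : ℝ)) / 2, by have := s.2.1; positivity, by have := s.2.2; linarith⟩
  have hl : Continuous l := by fun_prop
  have hr : Continuous r := by fun_prop
  have el : (γ.trans γ') ∘ l = γ := by
    ext s
    have h2 := s.2.2
    simp only [Function.comp_apply, Path.trans_apply, l]
    rw [dif_pos (by linarith)]
    congr 1
    ext
    simp only
    ring
  have er : (γ.trans γ') ∘ r = γ' := by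
    ext s
    have h1 := s.2.1
    simp only [Function.comp_apply, Path.trans_apply, r]
    split_ifs with h
    -- The junction 1/2 belongs to the first branch of `Path.trans`, so the start of γ' appears
    -- there as the end of γ.
    · have hs : s = 0 := Subtype.ext (by simp only [Icc.coe_zero]; linarith)
      subst hs
      rw [γ'.source]
      convert γ.target
      simp
    · congr 1
      ext
      simp only
      ring
  have h1 := hG.comp hl
  have h2 := hG.comp hr
  rw [el] at h1
  rw [er] at h2
  rw [hG.integral_eq, h1.integral_eq, h2.integral_eq]
  have e1 : l 0 = 0 := by ext; simp [l]
  have e2 : r 1 = 1 := by ext; norm_num [r]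
  have e3 : l 1 = r 0 := by ext; simp [l, r]
  simp only [Function.comp_apply, e1, e2, e3]
  ring

theorem integral_symm (ω : ClosedOneForm X) {x y : X} (γ : Path x y) :
    ω.integral γ.symm = - ω.integral γ := by
  obtain ⟨G, hG⟩ := ω.exists_isPrimitive_unitInterval γ.continuous
  have h : ω.IsPrimitive γ.symm (G ∘ unitInterval.symm) :=
    hG.comp unitInterval.continuous_symm
  rw [h.integral_eq, hG.integral_eq]
  simp

theorem integral_cast (ω : ClosedOneForm X) {x y x' y' : X} (γ : Path x y) (hx : x' = x)
    (hy : y' = y) : ω.integral (γ.cast hx hy) = ω.integral γ := by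
  subst hx hy
  rfl

theorem IsPrimitive.integral_map {p : C(Y, X)} {F : Y → ℝ} (h : ω.IsPrimitive p F) {a b : Y}
    (γ : Path a b) : ω.integral (γ.map p.continuous) = F b - F a := by
  have : ω.IsPrimitive (γ.map p.continuous) (F ∘ γ) := h.comp γ.continuous
  rw [this.integral_eq]
  simp

theorem integral_eq_of_forall_mem (ω : ClosedOneForm X) {x y : X} {γ : Path x y} {i : ω.ι}
    (h : ∀ s, γ s ∈ ω.U i) : ω.integral γ = ω.φ i y - ω.φ i x := by
  rw [(isPrimitive_of_forall_mem γ.continuous h).integral_eq]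
  simp

/-- If the cocycle is the coboundary of locally constant functions, correcting the chart functions
by them makes them agree on overlaps, and they glue. -/
theorem exists_isPrimitive_of_restrict_eq_zero {B : Set X}
    (h : ω.cechClass.restrict B = 0) :
    ∃ G, ω.IsPrimitive ((↑) : B → X) G := by
  obtain ⟨κ, W, r, s, f, h1, h2, h3, -, h5, h6⟩ := Quotient.exact h
  choose k hk using h2
  refine ⟨fun x => ω.φ (r (k x)) x + f (k x) x,
    isPrimitive_of_exists continuous_subtype_val fun y => ⟨r (k y), h3 _ (hk y), ?_⟩⟩
  filter_upwards [h5 (k y) y (hk y), (h1 (k y)).mem_nhds (hk y)] with z hz hzW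
  have := h6 (k y) (k z) z ⟨hzW, hk z⟩
  simp only [CechCocycle.trivial, CechCocycle.pullback, toCocycle, ContinuousMap.coe_mk] at this
  linarith

theorem integral_eq_of_range_subset {B : Set X} (h : ω.cechClass.restrict B = 0) {x y : X}
    (γ γ' : Path x y) (hγ : range γ ⊆ B) (hγ' : range γ' ⊆ B) :
    ω.integral γ = ω.integral γ' := by
  obtain ⟨G, hG⟩ := exists_isPrimitive_of_restrict_eq_zero h
  have key : ∀ σ : Path x y, ∀ hσ : range σ ⊆ B, ω.integral σ =
      G ⟨y, hσ ⟨1, σ.target⟩⟩ - G ⟨x, hσ ⟨0, σ.source⟩⟩ := by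
    intro σ hσ
    have hc : Continuous fun s => (⟨σ s, hσ ⟨s, rfl⟩⟩ : B) := σ.continuous.subtype_mk _
    have : ω.IsPrimitive σ (G ∘ fun s => (⟨σ s, hσ ⟨s, rfl⟩⟩ : B)) := hG.comp hc
    rw [this.integral_eq]
    simp
  rw [key γ hγ, key γ' hγ']

end ClosedOneForm

/-! ### Local homeomorphisms, coverings and monodromy -/

theorem IsLocalHomeomorph.locallyPathConnectedSpace {X E : Type*} [TopologicalSpace X]
    [TopologicalSpace E] [LocallyPathConnectedSpace X] {f : E → X} (hf : IsLocalHomeomorph f) :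
    LocallyPathConnectedSpace E := by
  refine ⟨fun e => ⟨fun s => ⟨fun hs => ?_, fun ⟨t, ht, hts⟩ => mem_of_superset ht.1 hts⟩⟩⟩
  obtain ⟨φ, he, rfl⟩ := hf e
  have hV : φ.target ∩ φ.symm ⁻¹' s ∈ 𝓝 (φ e) :=
    inter_mem (φ.open_target.mem_nhds (φ.map_source he))
      ((φ.continuousAt_symm (φ.map_source he)).preimage_mem_nhds (by rwa [φ.left_inv he]))
  obtain ⟨V, ⟨hVo, heV, hVc⟩, hVs⟩ := (isOpen_isPathConnected_basis (φ e)).mem_iff.1 hV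
  have hVs : V ⊆ φ.target ∩ φ.symm ⁻¹' s := hVs
  refine ⟨φ.symm '' V, ⟨?_, hVc.image' (φ.continuousOn_symm.mono (hVs.trans inter_subset_left))⟩,
    image_subset_iff.2 (hVs.trans inter_subset_right)⟩
  have := φ.symm.image_mem_nhds (x := φ e) (φ.map_source he) (hVo.mem_nhds heV)
  rwa [φ.left_inv he] at this

/-- The range is open, and so is its complement: over an evenly covered neighbourhood of a point
with empty fibre all fibres are empty. -/
theorem IsCoveringMap.surjective_of_preconnectedSpace {X E : Type*} [TopologicalSpace X]
    [TopologicalSpace E] [PreconnectedSpace X] [Nonempty E] {f : E → X} (hf : IsCoveringMap f) :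
    Function.Surjective f := by
  rw [← range_eq_univ]
  refine IsClopen.eq_univ ⟨⟨?_⟩, hf.isOpenMap.isOpen_range⟩ (range_nonempty f)
  rw [isOpen_iff_mem_nhds]
  intro x hx
  obtain ⟨hd, U, hxU, hU, hfU, H, hH⟩ := hf x
  have hempty : IsEmpty (f ⁻¹' {x}) := ⟨fun e => hx ⟨e, e.2⟩⟩
  filter_upwards [hU.mem_nhds hxU] with y hy
  rintro ⟨e, rfl⟩
  exact hempty.false (H ⟨e, hy⟩).2

theorem CechH1.cechClass_form {X : Type u} [TopologicalSpace X] [T2Space X] [ParacompactSpace X]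
    (ξ : CechH1 X) : ξ.form.cechClass = ξ := ξ.exists_form.choose_spec

/-- The monodromy of a class coming from E fixes `e₀`. So transport along γ to e and back along the
reverse of γ' returns to `e₀`; transport along γ' then takes `e₀` to e as well as to e'. -/
theorem IsCoveringMap.eq_of_mk_map_mem_range {X E : Type*} [TopologicalSpace X]
    [TopologicalSpace E] {p : C(E, X)} (hp : IsCoveringMap p) {e₀ e e' : E} (γ : Path e₀ e)
    (γ' : Path e₀ e') (h : p e = p e')
    (hmem : FundamentalGroup.fromPath (Path.Homotopic.Quotient.mk ((γ.map p.continuous).trans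
      ((γ'.map p.continuous).cast rfl h).symm)) ∈ (FundamentalGroup.map p e₀).range) : e = e' := by
  obtain ⟨β, hβ⟩ := hmem
  let β' : Path.Homotopic.Quotient e₀ e₀ := β
  have hβ' : β'.map p = (Path.Homotopic.Quotient.mk ((γ.map p.continuous).trans
      ((γ'.map p.continuous).cast rfl h).symm)) := hβ
  -- The endpoint x is kept free so that substitution absorbs the casts between the equal points `p
  -- e` and `p e'`.
  have key : ∀ (x : X) (hx : p e = x) (c : Path.Homotopic.Quotient (p e₀) x)
      (hc : c = (Path.Homotopic.Quotient.mk (γ.map p.continuous)).cast rfl hx.symm),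
      hp.monodromy c ⟨e₀, rfl⟩ = ⟨e, hx⟩ := by
    rintro x rfl c rfl
    exact hp.monodromy_map (Path.Homotopic.Quotient.mk γ)
  have key' : ∀ (x : X) (hx : p e' = x) (c : Path.Homotopic.Quotient (p e₀) x)
      (hc : c = (Path.Homotopic.Quotient.mk (γ'.map p.continuous)).cast rfl hx.symm),
      hp.monodromy c ⟨e₀, rfl⟩ = ⟨e', hx⟩ := by
    rintro x rfl c rfl
    exact hp.monodromy_map (Path.Homotopic.Quotient.mk γ')
  have h1 := key (p e) rfl _ rfl
  have h2 := key' (p e) h.symm _ rfl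
  have h3 : hp.monodromy (β'.map p) ⟨e₀, rfl⟩ = ⟨e₀, rfl⟩ := hp.monodromy_map β'
  rw [hβ', Path.Homotopic.Quotient.mk_trans, hp.monodromy_trans_apply] at h3
  rw [Path.Homotopic.Quotient.cast_rfl_rfl] at h1
  rw [h1, Path.Homotopic.Quotient.mk_symm, Path.Homotopic.Quotient.mk_cast] at h3
  rw [← h3, ← hp.monodromy_trans_apply, Path.Homotopic.Quotient.symm_trans] at h2
  rw [hp.monodromy_refl] at h2
  exact congrArg Subtype.val h2

/-! ### Primitive and deck transformations of the covering determined by the class -/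

namespace IsCoveringOfClass

variable {X : Type u} [MetricSpace X] {ξ : CechH1 X}
  {E : Type v} [TopologicalSpace E] {p : C(E, X)} {e₀ : E}

theorem pathConnectedSpace [LocallyPathConnectedSpace X] (hp : IsCoveringOfClass ξ p e₀) : PathConnectedSpace E :=
  have := hp.connected
  have := hp.isCoveringMap.isLocalHomeomorph.locallyPathConnectedSpace
  .of_locallyPathConnectedSpace

/-- The pullback of a form representing `ξ` to the covering determined by `ξ` is exact, and its
primitive separates the points of each fibre. -/
theorem exists_isPrimitive [LocallyPathConnectedSpace X] (hp : IsCoveringOfClass ξ p e₀) :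
    ∃ F : E → ℝ, ξ.form.IsPrimitive p F ∧ ∀ e e', p e = p e' → F e = F e' → e = e' := by
  have := hp.pathConnectedSpace
  have := hp.isCoveringMap.isLocalHomeomorph.locallyPathConnectedSpace
  have hloop : ∀ β : Path e₀ e₀, ξ.form.integral (β.map p.continuous) = 0 := fun β =>
    (hp.mem_range_iff _).1 ⟨FundamentalGroup.fromPath (Path.Homotopic.Quotient.mk β), rfl⟩
  refine ⟨fun e => ξ.form.integral ((PathConnectedSpace.somePath e₀ e).map p.continuous),
    ClosedOneForm.isPrimitive_of_exists p.continuous fun e => ?_, fun e e' h hF => ?_⟩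
  · obtain ⟨i, hi⟩ := ξ.form.cover (p e)
    obtain ⟨W, ⟨hW, hWc⟩, hWU⟩ := (path_connected_basis e).mem_iff.1
      (((ξ.form.isOpen i).preimage p.continuous).mem_nhds hi)
    refine ⟨i, hi, ?_⟩
    filter_upwards [hW] with z hz
    obtain ⟨τ, hτ⟩ := hWc.joinedIn e (mem_of_mem_nhds hW) z hz
    -- The chosen paths to e and z are unrelated; closing them up with τ gives a loop of zero
    -- period, so F z - F e is the integral over τ alone.
    have h1 := hloop (((PathConnectedSpace.somePath e₀ e).trans τ).trans
      (PathConnectedSpace.somePath e₀ z).symm)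
    rw [Path.map_trans, Path.map_trans, ← Path.map_symm, ClosedOneForm.integral_trans,
      ClosedOneForm.integral_trans, ClosedOneForm.integral_symm,
      ClosedOneForm.integral_eq_of_forall_mem (i := i) (γ := τ.map p.continuous) _
        (fun s => hWU (hτ s))] at h1
    linarith
  · refine hp.isCoveringMap.eq_of_mk_map_mem_range (PathConnectedSpace.somePath e₀ e)
      (PathConnectedSpace.somePath e₀ e') h ((hp.mem_range_iff _).2 ?_)
    rw [CechH1.period, ClosedOneForm.integral_trans, ClosedOneForm.integral_symm,
      ClosedOneForm.integral_cast]
    linarith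

/-- The deck transformations of the covering determined by `ξ` act transitively on fibres. -/
theorem exists_homeomorph [LocallyPathConnectedSpace X] (hp : IsCoveringOfClass ξ p e₀)
    {a a' : E} (h : p a = p a') :
    ∃ g : E ≃ₜ E, (∀ e, p (g e) = p e) ∧ g a = a' := by
  obtain ⟨F, hF, hinj⟩ := hp.exists_isPrimitive
  have := hp.pathConnectedSpace
  -- The projection of a path from b to e, lifted from b', has the same increment of F; its endpoint
  -- is the required point.
  have hex : ∀ {b b' : E}, p b = p b' → ∀ e, ∃ e', p e' = p e ∧ F e' = F e + (F b' - F b) := by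
    intro b b' hb e
    let γ := PathConnectedSpace.somePath b e
    obtain ⟨Γ, hΓ, hΓ0⟩ := hp.isCoveringMap.exists_path_lifts
      (γ.map p.continuous : C(unitInterval, X)) b' (by simpa using hb)
    have h1 : ξ.form.IsPrimitive (p ∘ γ) (F ∘ γ) := hF.comp γ.continuous
    have h2 : ξ.form.IsPrimitive (p ∘ Γ) (F ∘ Γ) := hF.comp Γ.continuous
    have hΓ' : p ∘ Γ = p ∘ γ := hΓ
    rw [hΓ'] at h2
    have h3 := h2.sub_eq_sub h1 0 1
    simp only [Function.comp_apply, hΓ0, Path.source, Path.target] at h3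
    refine ⟨Γ 1, ?_, by linarith⟩
    simpa using congrFun hΓ' 1
  -- Near e, such a map coincides with a local inverse of p composed with p: both values lie over
  -- the same point and have equal F.
  have hcont : ∀ (g : E → E) (c : ℝ), (∀ e, p (g e) = p e) → (∀ e, F (g e) = F e + c) →
      Continuous g := by
    intro g c hpg hFg
    rw [continuous_iff_continuousAt]
    intro e
    obtain ⟨φ, he, hφ⟩ := hp.isCoveringMap.isLocalHomeomorph (g e)
    have het : p e ∈ φ.target := by
      rw [← hpg e, hφ]
      exact φ.map_source he
    have hse : φ.symm (p e) = g e := by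
      rw [← hpg e, hφ]
      exact φ.left_inv he
    have hs : ContinuousAt (fun z => φ.symm (p z)) e :=
      (φ.continuousAt_symm het).comp p.continuous.continuousAt
    obtain ⟨i, hi⟩ := ξ.form.cover (p e)
    refine hs.congr ?_
    have h1 := hF i (g e) (by rwa [hpg])
    rw [← hse] at h1
    filter_upwards [hs.eventually h1, hF i e hi,
      p.continuous.continuousAt.eventually (φ.open_target.mem_nhds het)] with z hz hz' hzt
    have hpz : p (φ.symm (p z)) = p z := by
      have := φ.right_inv hzt
      rwa [← hφ] at this
    rw [hpz, hse, hpg, hFg] at hz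
    exact hinj _ _ (by rw [hpz, hpg]) (by rw [hFg]; linarith)
  choose g hg hFg using hex h
  choose g' hg' hFg' using hex h.symm
  refine ⟨⟨⟨g, g', fun e => ?_, fun e => ?_⟩, hcont g _ hg hFg, hcont g' _ hg' hFg'⟩, hg, ?_⟩
  · exact hinj _ _ (by rw [hg', hg]) (by rw [hFg', hFg]; ring)
  · exact hinj _ _ (by rw [hg, hg']) (by rw [hFg, hFg']; ring)
  · exact hinj _ _ (by rw [← h]; exact hg a) ((hFg a).trans (by ring))

/-- Invariance along fibres turns a local estimate on E into one on the compact base, where finitely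
many radii have a positive minimum. -/
theorem exists_forall_of_eventually [CompactSpace X] [ConnectedSpace X]
    (hp : IsCoveringOfClass ξ p e₀) {P : ℝ → E → Prop}
    (anti : ∀ r r' a, r ≤ r' → P r' a → P r a)
    (inv : ∀ r a a', p a = p a' → P r a → P r a')
    (loc : ∀ e, ∃ r > 0, ∀ᶠ a in 𝓝 e, P r a) : ∃ r > 0, ∀ a, P r a := by
  have := hp.connected
  have key : ∃ r > 0, ∀ x ∈ (univ : Set X), ∀ a, p a = x → P r a := by
    refine isCompact_univ.induction_on ⟨1, one_pos, by simp⟩ ?_ ?_ ?_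
    · rintro s t hst ⟨r, hr, h⟩
      exact ⟨r, hr, fun x hx => h x (hst hx)⟩
    · rintro s t ⟨r, hr, h⟩ ⟨r', hr', h'⟩
      refine ⟨min r r', lt_min hr hr', fun x hx a ha => ?_⟩
      rcases hx with hx | hx
      · exact anti _ _ _ (min_le_left _ _) (h x hx a ha)
      · exact anti _ _ _ (min_le_right _ _) (h' x hx a ha)
    · intro x _
      obtain ⟨e, rfl⟩ := hp.isCoveringMap.surjective_of_preconnectedSpace x
      obtain ⟨r, hr, h⟩ := loc e
      refine ⟨p '' {a | P r a}, mem_nhdsWithin_of_mem_nhds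
        (hp.isCoveringMap.isOpenMap.image_mem_nhds h), r, hr, ?_⟩
      rintro _ ⟨a, ha, rfl⟩ a' ha'
      exact inv r a a' ha'.symm ha
  obtain ⟨r, hr, h⟩ := key
  exact ⟨r, hr, fun a => h _ (mem_univ _) a rfl⟩

end IsCoveringOfClass

/-! ### Uniform comparison of distances and lifting of short jumps -/

namespace IsCoveringOfClass

variable {X : Type u} [MetricSpace X] [CompactSpace X] [ConnectedSpace X]
  [LocallyPathConnectedSpace X] {ξ : CechH1 X} {E : Type v} [MetricSpace E] {p : C(E, X)} {e₀ : E}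

/-- A metric on the covering that is invariant and locally isometric over `X` is uniformly so:
nearby points are joined by a path whose projection is small. -/
theorem exists_dist_eq_and_path (hp : IsCoveringOfClass ξ p e₀)
    (hinv : ∀ g : E ≃ₜ E, (∀ e, p (g e) = p e) → ∀ a b, dist (g a) (g b) = dist a b)
    (hiso : ∀ e : E, ∃ V ∈ 𝓝 e, ∀ a ∈ V, ∀ b ∈ V, dist (p a) (p b) = dist a b)
    {ε : ℝ} (hε : 0 < ε) : ∃ r > 0, ∀ a b : E, dist a b < r → dist (p a) (p b) = dist a b ∧
      ∃ τ : Path a b, ∀ s, p (τ s) ∈ Metric.ball (p a) ε := by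
  have := hp.isCoveringMap.isLocalHomeomorph.locallyPathConnectedSpace
  refine hp.exists_forall_of_eventually (P := fun r a => ∀ b : E, dist a b < r →
    dist (p a) (p b) = dist a b ∧ ∃ τ : Path a b, ∀ s, p (τ s) ∈ Metric.ball (p a) ε)
    (fun r r' a hr h b hb => h b (hb.trans_le hr)) (fun r a a' ha h b' hb' => ?_) fun e => ?_
  · obtain ⟨g, hg, rfl⟩ := hp.exists_homeomorph ha
    have hd := hinv g hg a (g.symm b')
    rw [g.apply_symm_apply] at hd
    obtain ⟨h1, τ, hτ⟩ := h (g.symm b') (hd ▸ hb')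
    have hb : p b' = p (g.symm b') := by
      rw [← hg (g.symm b'), g.apply_symm_apply]
    refine ⟨by rw [hg, hb, h1, hd], (τ.map g.continuous).cast rfl (g.apply_symm_apply b').symm,
      fun s => ?_⟩
    simpa [hg] using hτ s
  · obtain ⟨V, hV, hVd⟩ := hiso e
    -- Half of ε, since W is controlled around `p e` while the final ball is centred at `p a`.
    obtain ⟨W, ⟨hW, hWc⟩, hWV⟩ := (path_connected_basis e).mem_iff.1 (inter_mem hV
      (p.continuous.continuousAt.preimage_mem_nhds (Metric.ball_mem_nhds (p e) (half_pos hε))))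
    have hWV : W ⊆ V ∩ p ⁻¹' Metric.ball (p e) (ε / 2) := hWV
    obtain ⟨r, hr, hrW⟩ := Metric.mem_nhds_iff.1 hW
    refine ⟨r / 2, half_pos hr, ?_⟩
    filter_upwards [Metric.ball_mem_nhds e (half_pos hr)] with a ha b hb
    rw [Metric.mem_ball] at ha
    have haW : a ∈ W := hrW (by rw [Metric.mem_ball]; linarith)
    have hbW : b ∈ W := hrW (by
      rw [Metric.mem_ball]
      have := dist_triangle_left b e a
      linarith)
    refine ⟨hVd a (hWV haW).1 b (hWV hbW).1, ?_⟩
    obtain ⟨τ, hτ⟩ := hWc.joinedIn a haW b hbW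
    refine ⟨τ, fun s => ?_⟩
    have h1 := (hWV (hτ s)).2
    have h2 := (hWV haW).2
    rw [mem_preimage, Metric.mem_ball] at h1 h2
    rw [Metric.mem_ball]
    have := dist_triangle_right (p (τ s)) (p a) (p e)
    linarith

/-- Points of `X` near the projection of `a` lift uniformly to points near `a`. -/
theorem exists_lift_and_path (hp : IsCoveringOfClass ξ p e₀)
    (hinv : ∀ g : E ≃ₜ E, (∀ e, p (g e) = p e) → ∀ a b, dist (g a) (g b) = dist a b)
    {ε ρ : ℝ} (hε : 0 < ε) (hρ : 0 < ρ) : ∃ r > 0, ∀ (a : E) (y : X), dist (p a) y < r →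
      ∃ b, p b = y ∧ dist a b < ρ ∧ ∃ τ : Path a b, ∀ s, p (τ s) ∈ Metric.ball (p a) ε := by
  have := hp.isCoveringMap.isLocalHomeomorph.locallyPathConnectedSpace
  refine hp.exists_forall_of_eventually (P := fun r a => ∀ y : X, dist (p a) y < r →
    ∃ b, p b = y ∧ dist a b < ρ ∧ ∃ τ : Path a b, ∀ s, p (τ s) ∈ Metric.ball (p a) ε)
    (fun r r' a hr h y hy => h y (hy.trans_le hr)) (fun r a a' ha h y hy => ?_) fun e => ?_
  -- A deck transformation carries the lift and its path to the other point of the fibre, preserving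
  -- distances and projections.
  · obtain ⟨g, hg, rfl⟩ := hp.exists_homeomorph ha
    obtain ⟨b, hb, hd, τ, hτ⟩ := h y (by rwa [ha])
    refine ⟨g b, by rw [hg, hb], by rwa [hinv g hg], τ.map g.continuous, fun s => ?_⟩
    simpa [hg] using hτ s
  · obtain ⟨W, ⟨hW, hWc⟩, hWV⟩ := (path_connected_basis e).mem_iff.1
      (inter_mem (Metric.ball_mem_nhds e (half_pos hρ))
      (p.continuous.continuousAt.preimage_mem_nhds (Metric.ball_mem_nhds (p e) (half_pos hε))))
    have hWV : W ⊆ Metric.ball e (ρ / 2) ∩ p ⁻¹' Metric.ball (p e) (ε / 2) := hWV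
    obtain ⟨r, hr, hrW⟩ :=
      Metric.mem_nhds_iff.1 (hp.isCoveringMap.isOpenMap.image_mem_nhds hW)
    refine ⟨r / 2, half_pos hr, ?_⟩
    filter_upwards [hW, p.continuous.continuousAt.preimage_mem_nhds
      (Metric.ball_mem_nhds (p e) (half_pos hr))] with a haW ha y hy
    rw [mem_preimage, Metric.mem_ball] at ha
    obtain ⟨b, hbW, rfl⟩ : y ∈ p '' W := hrW (by
      rw [Metric.mem_ball]
      have := dist_triangle_left y (p e) (p a)
      linarith)
    obtain ⟨τ, hτ⟩ := hWc.joinedIn a haW b hbW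
    refine ⟨b, rfl, ?_, τ, fun s => ?_⟩
    · have h1 := (hWV haW).1
      have h2 := (hWV hbW).1
      rw [Metric.mem_ball] at h1 h2
      have := dist_triangle_right a b e
      linarith
    · have h1 := (hWV (hτ s)).2
      have h2 := (hWV haW).2
      rw [mem_preimage, Metric.mem_ball] at h1 h2
      rw [Metric.mem_ball]
      have := dist_triangle_right (p (τ s)) (p a) (p e)
      linarith

end IsCoveringOfClass

/-! ### Lifting and projecting chains -/

theorem ClosedOneForm.IsPrimitive.integral_orbitPath {X : Type u} [TopologicalSpace X]
    {ω : ClosedOneForm X} {E : Type v} [TopologicalSpace E] {p : C(E, X)} {F : E → ℝ}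
    (hF : ω.IsPrimitive p F) {Φ : Flow ℝ X} {Φ' : Flow ℝ E}
    (hlift : ∀ t e, p (Φ' t e) = Φ t (p e)) {a : E} {x : X} (hx : p a = x) (t : ℝ) :
    ω.integral (Φ.orbitPath x t) = F (Φ' t a) - F a := by
  subst hx
  have : Φ.orbitPath (p a) t =
      ((Φ'.orbitPath a t).map p.continuous).cast rfl (hlift t a).symm := by
    ext s
    exact (hlift _ a).symm
  rw [this, integral_cast, hF.integral_map]

/-- The pairing with a chain that lifts to the points `y i` telescopes. -/
theorem DynChain.pairing_eq {X : Type u} [MetricSpace X] {Φ : Flow ℝ X} {δ T : ℝ} {x : X}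
    (C : DynChain Φ δ T x x) {ξ : CechH1 X} {ε : ℝ} (s : C.Connection ε) {E : Type v}
    [TopologicalSpace E] {p : C(E, X)} {F : E → ℝ} (hF : ξ.form.IsPrimitive p F) {Φ' : Flow ℝ E}
    (hlift : ∀ t e, p (Φ' t e) = Φ t (p e)) (y : Fin (C.N + 1) → E) (hy : ∀ i, p (y i) = C.x i)
    (hs : ∀ i, ξ.form.integral (s.σ i) = F (y i.succ) - F (Φ' (C.t i) (y i.castSucc))) :
    C.pairing ξ s = F (y (Fin.last C.N)) - F (y 0) := by
  have h1 := Fin.sum_univ_succ fun i => F (y i)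
  have h2 := Fin.sum_univ_castSucc fun i => F (y i)
  rw [DynChain.pairing, ← Finset.sum_add_distrib]
  have : ∀ i : Fin C.N, ξ.form.integral (Φ.orbitPath (C.x i.castSucc) (C.t i)) +
      ξ.form.integral (s.σ i) = F (y i.succ) - F (y i.castSucc) := fun i => by
    rw [hF.integral_orbitPath hlift (hy _), hs]
    ring
  rw [Finset.sum_congr rfl fun i _ => this i, Finset.sum_sub_distrib]
  linarith

theorem proposition3 {X : Type u} [MetricSpace X] [CompactSpace X] [ConnectedSpace X]
    [LocallyPathConnectedSpace X] (Φ : Flow ℝ X) (ξ : CechH1 X)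
    {E : Type v} [MetricSpace E] (p : C(E, X)) (e₀ : E) (hp : IsCoveringOfClass ξ p e₀)
    (Φ' : Flow ℝ E) (hlift : ∀ t e, p (Φ' t e) = Φ t (p e))
    (hinv : ∀ g : E ≃ₜ E, (∀ e, p (g e) = p e) → ∀ a b, dist (g a) (g b) = dist a b)
    (hiso : ∀ e : E, ∃ V ∈ 𝓝 e, ∀ a ∈ V, ∀ b ∈ V, dist (p a) (p b) = dist a b) :
    ∀ ε δ, IsScale ξ ε δ → chainRecurrentSetOfClass Φ ξ ε δ = p '' chainRecurrentSet Φ' := by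
  intro ε δ hscale
  obtain ⟨F, hF, hinj⟩ := hp.exists_isPrimitive
  have := hp.connected
  apply Subset.antisymm
  · intro x hx
    obtain ⟨e, rfl⟩ := hp.isCoveringMap.surjective_of_preconnectedSpace x
    refine ⟨e, fun ρ T hρ hT => ?_, rfl⟩
    obtain ⟨r, hr, hlft⟩ := hp.exists_lift_and_path hinv hscale.ε_pos hρ
    -- Halving δ and adding 1 to T meet the strict bounds δ' < δ and T > 1 in the definition of
    -- `chainRecurrentSetOfClass`.
    obtain ⟨C, hC⟩ := hx (min r (δ / 2)) (T + 1) (lt_min hr (half_pos hscale.δ_pos))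
      ((min_le_right _ _).trans_lt (half_lt_self hscale.δ_pos)) (by linarith)
    have hstep : ∀ (i : Fin C.N) (a : {a // p a = C.x i.castSucc}), ∃ b, p b = C.x i.succ ∧
        dist (Φ' (C.t i) a) b < ρ ∧ ∃ τ : Path (Φ' (C.t i) a) b,
          ∀ s, p (τ s) ∈ Metric.ball (p (Φ' (C.t i) a)) ε := fun i a =>
      hlft _ _ (by
        rw [hlift, a.2]
        exact (C.dist_lt i).trans_le (min_le_left _ _))
    choose b hb hdist τ hτ using hstep
    let y : ∀ i : Fin (C.N + 1), {a // p a = C.x i} :=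
      fun i => Fin.induction (motive := fun i => {a // p a = C.x i})
        ⟨e, C.x_zero.symm⟩ (fun i a => ⟨b i a, hb i a⟩) i
    have hy0 : (y 0 : E) = e := rfl
    have hys : ∀ i : Fin C.N, (y i.succ : E) = b i (y i.castSucc) := fun i => by
      simp only [y, Fin.induction_succ]
    -- The projected lifting paths stay in ε-balls around their starting points, so they form an
    -- admissible connection, to which the vanishing applies.
    let s : C.Connection ε :=
      { σ := fun i => ((τ i (y i.castSucc)).map p.continuous).cast
          (by rw [hlift, (y i.castSucc).2]) (hb i _).symm
        small := fun i => ⟨_, range_subset_iff.2 fun s => hτ i (y i.castSucc) s⟩ }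
    have hpair := C.pairing_eq s hF hlift (fun i => (y i : E)) (fun i => (y i).2) fun i => by
      simp only [s]
      rw [ClosedOneForm.integral_cast, hF.integral_map, hys]
    rw [hC s, hy0] at hpair
    -- Zero pairing means that both ends of the lifted chain have equal F; they lie in one fibre, so
    -- they coincide.
    have hlast : (y (Fin.last C.N) : E) = e :=
      hinj _ _ ((y (Fin.last C.N)).2.trans C.x_last) (by linarith)
    exact ⟨⟨C.N, C.pos, fun i => y i, C.t, hy0, hlast,
      fun i => (by linarith [C.le_t i]), fun i => (hys i).symm ▸ hdist i _⟩⟩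
  · rintro _ ⟨e, he, rfl⟩ δ' T hδ' _ hT
    -- Radius 2ε is allowed here, since ξ vanishes on such balls.
    obtain ⟨r, hr, hpath⟩ := hp.exists_dist_eq_and_path hinv hiso
      (mul_pos two_pos hscale.ε_pos)
    obtain ⟨D⟩ := he (min r δ') T (lt_min hr hδ') hT.le
    have hD : ∀ i : Fin D.N, dist (Φ' (D.t i) (D.x i.castSucc)) (D.x i.succ) < r := fun i =>
      (D.dist_lt i).trans_le (min_le_left _ _)
    refine ⟨⟨D.N, D.pos, fun i => p (D.x i), D.t, congrArg p D.x_zero, congrArg p D.x_last,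
      D.le_t, fun i => ?_⟩, fun s => ?_⟩
    · rw [← hlift, (hpath _ _ (hD i)).1]
      exact (D.dist_lt i).trans_le (min_le_right _ _)
    · rw [DynChain.pairing_eq _ s hF hlift D.x (fun _ => rfl) fun i => ?_]
      · exact sub_eq_zero.2 (congrArg F (D.x_last.trans D.x_zero.symm))
      · obtain ⟨-, τ, hτ⟩ := hpath _ _ (hD i)
        rw [← hF.integral_map τ, ← ξ.form.integral_cast (τ.map p.continuous) (hlift _ _).symm rfl]
        refine ClosedOneForm.integral_eq_of_range_subset
          (B := Metric.ball (p (Φ' (D.t i) (D.x i.castSucc))) (2 * ε)) ?_ _ _ ?_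
          (range_subset_iff.2 hτ)
        · rw [CechH1.cechClass_form]
          exact hscale.restrict_ball _
        -- The ε-ball containing the given path also contains its starting point, hence lies in the
        -- 2ε-ball around that point, as the projection of τ does.
        · obtain ⟨c, hc⟩ := s.small i
          refine hc.trans (Metric.ball_subset_ball' ?_)
          have hmem : p (Φ' (D.t i) (D.x i.castSucc)) ∈ Metric.ball c ε := by
            rw [hlift]
            exact hc ⟨0, (s.σ i).source⟩
          rw [Metric.mem_ball, dist_comm] at hmem
          linarith
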